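/- Let $X$ be a complex Hilbert space and let $A$ be the generator of an exponentially stable $C_0$-semigroup $(T(t))_{t\ge 0}$ on $X$ (that is, $\|T(t)\|\le Me^{-\omega t}$ for some $M$ and some $\omega>0$). Assume that (a) $D(A)\subset D(A^*)$; (b) there is $\delta<1$ such that $\operatorname{Re}\langle A^*A^{-1}x,x\rangle+\delta\|x\|^2\ge 0$ for every $x\in X$; (c) $\operatorname{Re}\langle Ax,x\rangle<0$ for every $x\in D(A)\setminus\{0\}$. For $\beta$ in the resolvent set of $A$, let $X_{-1}$ be the completion of $X$ with respect to the norm $\|(\beta I-A)^{-1}x\|$, and let $T_{-1}(t)$ be the extension of $T(t)$ to a bounded operator on $X_{-1}$. Let $U$ be a complex Banach space. An operator $B\in L(U,X_{-1})$ is called $\infty$-admissible if $\int_0^t T_{-1}(t-s)Bu(s)\,ds\in X$ for all $t\ge 0$ and all $u\in L^\infty(\mathbb R_+,U)$; then $\phi(t,x,u)=T(t)x+\int_0^tT_{-1}(t-s)Bu(s)\,ds\in X$ is the transition map of the system $\dot x=Ax+Bu$ with input space $L^\infty(\mathbb R_+,U)$. Then $A$ has a bounded inverse $A^{-1}\in L(X)$,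 and for every $\infty$-admissible $B\in L(U,X_{-1})$ the function $V(x):=-\operatorname{Re}\langle A^{-1}x,x\rangle$ is a (non-coercive) ISS Lyapunov function for $\dot x=Ax+Bu$. That is: $V:X\to[0,\infty)$ is continuous, and there are $\psi_2,\alpha\in\mathcal K_\infty$ and $\sigma\in\mathcal K$ such that $0<V(x)\le\psi_2(\|x\|)$ for all $x\ne 0$ and $$\limsup_{t\to 0+}\frac{V(\phi(t,x,u))-V(x)}{t}\le-\alpha(\|x\|)+\sigma(\|u\|_{L^\infty})\qquad\text{for all }x\in X,\ u\in L^\infty(\mathbb R_+,U).$$ Here $\mathcal K$ is the set of continuous, strictly increasing functions $\gamma:[0,\infty)\to[0,\infty)$ with $\gamma(0)=0$, and $\mathcal K_\infty$ is the set of unbounded functions in $\mathcal K$. -/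

import Mathlib

open Filter Topology MeasureTheory
open scoped NNReal ENNReal InnerProductSpace LinearPMap

noncomputable section

namespace ISS

section Operators

variable {X : Type*} [NormedAddCommGroup X] [NormedSpace ℂ X]

/-- A strongly continuous semigroup of bounded linear operators on `X`. -/
structure C0Semigroup (X : Type*) [NormedAddCommGroup X] [NormedSpace ℂ X] where
  toFun : ℝ≥0 → X →L[ℂ] X
  map_zero' : toFun 0 = ContinuousLinearMap.id ℂ X
  map_add' : ∀ s t, toFun (s + t) = (toFun s).comp (toFun t)
  continuous' : ∀ x, Continuous fun t => toFun t x

instance : CoeFun (C0Semigroup X) fun _ => ℝ≥0 → X →L[ℂ] X := ⟨C0Semigroup.toFun⟩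

/-- `A` is the infinitesimal generator of `T`: the domain of `A` consists of exactly those `x` for
which `(T(t)x - x)/t` converges as `t → 0+`, and `A x` is the limit. -/
def C0Semigroup.IsGenerator (T : C0Semigroup X) (A : X →ₗ.[ℂ] X) : Prop :=
  ∀ x y : X, (x, y) ∈ A.graph ↔
    Tendsto (fun t : ℝ≥0 => ((t : ℝ)⁻¹) • (T t x - x)) (𝓝[>] 0) (𝓝 y)

/-- `‖T(t)‖ ≤ M e^{-ωt}` for some `M` and some `ω > 0`. -/
def C0Semigroup.ExponentiallyStable (T : C0Semigroup X) : Prop :=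
  ∃ M ω : ℝ, 0 < ω ∧ ∀ t : ℝ≥0, ‖T t‖ ≤ M * Real.exp (-ω * t)

/-- `S` is an everywhere defined bounded two-sided inverse of the operator `A : D(A) → X`. -/
structure IsBoundedInverse (A : X →ₗ.[ℂ] X) (S : X →L[ℂ] X) : Prop where
  mem_domain : ∀ x, S x ∈ A.domain
  right_inv : ∀ x, A ⟨S x, mem_domain x⟩ = x
  left_inv : ∀ x : A.domain, S (A x) = x

open Classical in
/-- The bounded inverse `A⁻¹` of `A` (with the value `0` if `A` has no bounded inverse). -/
def boundedInverse (A : X →ₗ.[ℂ] X) : X →L[ℂ] X :=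
  if h : ∃ S, IsBoundedInverse A S then h.choose else 0

/-- The operator `β I - A` with domain `D(A)`. -/
def shifted (A : X →ₗ.[ℂ] X) (β : ℂ) : X →ₗ.[ℂ] X where
  domain := A.domain
  toFun := β • A.domain.subtype - A.toFun

/-- The resolvent set of `A`. -/
def resolventSet (A : X →ₗ.[ℂ] X) : Set ℂ :=
  {β | ∃ S, IsBoundedInverse (shifted A β) S}

/-- The resolvent `(β I - A)⁻¹`. -/
def resolvent (A : X →ₗ.[ℂ] X) (β : ℂ) : X →L[ℂ] X := boundedInverse (shifted A β)

lemma isBoundedInverse_resolvent {A : X →ₗ.[ℂ] X} {β : ℂ} (hβ : β ∈ resolventSet A) :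
    IsBoundedInverse (shifted A β) (resolvent A β) := by
  have h : ∃ S, IsBoundedInverse (shifted A β) S := hβ
  simp only [resolvent, boundedInverse, dif_pos h]
  exact h.choose_spec

lemma C0Semigroup.IsGenerator.map_mem {T : C0Semigroup X} {A : X →ₗ.[ℂ] X}
    (hA : T.IsGenerator A) (t : ℝ≥0) {x y : X} (h : (x, y) ∈ A.graph) :
    (T t x, T t y) ∈ A.graph := by
  rw [hA] at h ⊢
  refine (((T t).continuous.tendsto y).comp h).congr fun s => ?_
  have e : T t (T s x) = T s (T t x) := by
    have h1 := congrArg (fun S => S x) (T.map_add' t s)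
    have h2 := congrArg (fun S => S x) (T.map_add' s t)
    rw [add_comm] at h2
    exact h1.symm.trans h2
  have key : T t (((s : ℝ)⁻¹) • (T s x - x)) = ((s : ℝ)⁻¹) • (T t (T s x - x)) :=
    ((T t).restrictScalars ℝ).map_smul _ _
  simp only [Function.comp_apply, key, map_sub, e]

/-- The semigroup commutes with the resolvents of its generator. -/
lemma resolvent_comm {T : C0Semigroup X} {A : X →ₗ.[ℂ] X} (hA : T.IsGenerator A) {β : ℂ}
    (hβ : β ∈ resolventSet A) (t : ℝ≥0) (x : X) :
    resolvent A β (T t x) = T t (resolvent A β x) := by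
  have hR := isBoundedInverse_resolvent hβ
  have hmem : resolvent A β x ∈ A.domain := hR.mem_domain x
  have hx : β • resolvent A β x - A ⟨_, hmem⟩ = x := hR.right_inv x
  have hg := hA.map_mem t (A.mem_graph ⟨_, hmem⟩)
  obtain ⟨hd, hy⟩ := (LinearPMap.mem_graph_iff' A).1 hg |>.imp fun _ h => h
  have hdom : T t (resolvent A β x) ∈ A.domain := LinearPMap.mem_domain_of_mem_graph hg
  have hval : A ⟨_, hdom⟩ = T t (A ⟨_, hmem⟩) :=
    A.mem_graph_snd_inj (A.mem_graph ⟨_, hdom⟩) hg rfl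
  have hl : resolvent A β (β • T t (resolvent A β x) - A ⟨_, hdom⟩)
      = T t (resolvent A β x) := hR.left_inv ⟨_, hdom⟩
  rw [hval, ← map_smul, ← map_sub, hx] at hl
  exact hl

/-- The space `X` equipped with the norm `‖x‖₋₁ = ‖(β I - A)⁻¹ x‖`. -/
@[nolint unusedArguments]
def ExtrapolationCore (_A : X →ₗ.[ℂ] X) (_β : ℂ) : Type _ := X

instance (A : X →ₗ.[ℂ] X) (β : ℂ) : AddCommGroup (ExtrapolationCore A β) :=
  inferInstanceAs (AddCommGroup X)

instance (A : X →ₗ.[ℂ] X) (β : ℂ) : Module ℂ (ExtrapolationCore A β) :=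
  inferInstanceAs (Module ℂ X)

/-- The identity map from `X` to `X` with the weaker norm. -/
def toCore (A : X →ₗ.[ℂ] X) (β : ℂ) : X ≃ₗ[ℂ] ExtrapolationCore A β := LinearEquiv.refl ℂ X

instance (A : X →ₗ.[ℂ] X) (β : ℂ) : SeminormedAddCommGroup (ExtrapolationCore A β) :=
  SeminormedAddCommGroup.induced _ X
    ((resolvent A β).toLinearMap ∘ₗ (toCore A β).symm.toLinearMap)

lemma norm_core (A : X →ₗ.[ℂ] X) (β : ℂ) (x : ExtrapolationCore A β) :
    ‖x‖ = ‖resolvent A β ((toCore A β).symm x)‖ := rfl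

instance (A : X →ₗ.[ℂ] X) (β : ℂ) : NormedSpace ℂ (ExtrapolationCore A β) where
  norm_smul_le c x := by simp [norm_core, norm_smul]

/-- The extrapolation space `X₋₁`: the completion of `X` with respect to
`‖x‖₋₁ = ‖(β I - A)⁻¹ x‖`, where `β` is a point of the resolvent set. -/
abbrev Extrapolation (A : X →ₗ.[ℂ] X) (β : ℂ) : Type _ :=
  UniformSpace.Completion (ExtrapolationCore A β)

/-- The canonical inclusion `X → X₋₁`. -/
def incl (A : X →ₗ.[ℂ] X) (β : ℂ) (x : X) : Extrapolation A β := (toCore A β x : Extrapolation A β)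

lemma norm_incl (A : X →ₗ.[ℂ] X) (β : ℂ) (x : X) : ‖incl A β x‖ = ‖resolvent A β x‖ := by
  simp [incl, norm_core]

lemma incl_sub (A : X →ₗ.[ℂ] X) (β : ℂ) (x y : X) :
    incl A β (x - y) = incl A β x - incl A β y := by
  simp [incl, UniformSpace.Completion.coe_sub]

lemma incl_injective {A : X →ₗ.[ℂ] X} {β : ℂ} (hβ : β ∈ resolventSet A) :
    Function.Injective (incl A β) := by
  intro x y h
  have h0 : ‖resolvent A β (x - y)‖ = 0 := by
    rw [← norm_incl, incl_sub, h, sub_self, norm_zero]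
  have hR := isBoundedInverse_resolvent hβ
  have hz : (⟨resolvent A β (x - y), hR.mem_domain _⟩ : (shifted A β).domain) = 0 :=
    Subtype.ext (norm_eq_zero.1 h0)
  have := hR.right_inv (x - y)
  rw [hz, LinearPMap.map_zero] at this
  exact sub_eq_zero.1 this.symm

/-- `T(t)` as a bounded operator on `X` with the norm `‖·‖₋₁`. -/
def coreSemigroup {T : C0Semigroup X} {A : X →ₗ.[ℂ] X} (hA : T.IsGenerator A) {β : ℂ}
    (hβ : β ∈ resolventSet A) (t : ℝ≥0) : ExtrapolationCore A β →L[ℂ] ExtrapolationCore A β :=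
  LinearMap.mkContinuous
    ((toCore A β).toLinearMap ∘ₗ (T t).toLinearMap ∘ₗ (toCore A β).symm.toLinearMap) ‖T t‖
    fun x => by
      simpa [norm_core, resolvent_comm hA hβ] using
        (T t).le_opNorm (resolvent A β ((toCore A β).symm x))

/-- The extension `T₋₁(t)` of `T(t)` to a bounded operator on `X₋₁`. -/
def extSemigroup {T : C0Semigroup X} {A : X →ₗ.[ℂ] X} (hA : T.IsGenerator A) {β : ℂ}
    (hβ : β ∈ resolventSet A) (t : ℝ≥0) : Extrapolation A β →L[ℂ] Extrapolation A β :=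
  (coreSemigroup hA hβ t).completion

lemma extSemigroup_incl {T : C0Semigroup X} {A : X →ₗ.[ℂ] X} (hA : T.IsGenerator A) {β : ℂ}
    (hβ : β ∈ resolventSet A) (t : ℝ≥0) (x : X) :
    extSemigroup hA hβ t (incl A β x) = incl A β (T t x) := by
  simp [extSemigroup, incl, coreSemigroup]

end Operators

section Systems

/-- The input space `L^q(ℝ₊, U)`. -/
abbrev Input (U : Type*) [NormedAddCommGroup U] (q : ℝ≥0∞) : Type _ :=
  Lp U q ((volume : Measure ℝ).restrict (Set.Ici 0))

variable {X U : Type*} [NormedAddCommGroup X] [NormedSpace ℂ X]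
  [NormedAddCommGroup U] [NormedSpace ℂ U]
  {T : C0Semigroup X} {A : X →ₗ.[ℂ] X} {β : ℂ}

/-- `∫₀ᵗ T₋₁(t-s) B u(s) ds`, a Bochner integral in `X₋₁`. -/
def inputIntegral (hA : T.IsGenerator A) (hβ : β ∈ resolventSet A)
    (B : U →L[ℂ] Extrapolation A β) (t : ℝ≥0) (u : ℝ → U) : Extrapolation A β :=
  ∫ s in (0 : ℝ)..t, extSemigroup hA hβ (Real.toNNReal (t - s)) (B (u s))

/-- `B` is a `q`-admissible control operator: `∫₀ᵗ T₋₁(t-s) B u(s) ds` belongs to `X` for all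
`t ≥ 0` and `u ∈ L^q(ℝ₊, U)`. -/
def IsAdmissible (hA : T.IsGenerator A) (hβ : β ∈ resolventSet A)
    (B : U →L[ℂ] Extrapolation A β) (q : ℝ≥0∞) : Prop :=
  ∀ (t : ℝ≥0) (u : Input U q), ∃ x : X, incl A β x = inputIntegral hA hβ B t u

/-- The transition map `φ(t, x₀, u) = T(t) x₀ + ∫₀ᵗ T₋₁(t-s) B u(s) ds` of the system
`ẋ = A x + B u`, as an element of `X`. -/
def transition {hA : T.IsGenerator A} {hβ : β ∈ resolventSet A}
    {B : U →L[ℂ] Extrapolation A β} {q : ℝ≥0∞} (hB : IsAdmissible hA hβ B q)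
    (t : ℝ≥0) (x₀ : X) (u : Input U q) : X :=
  T t x₀ + (hB t u).choose

end Systems

section Lyapunov

/-- Comparison functions of class `K`. -/
structure IsClassK (γ : ℝ≥0 → ℝ≥0) : Prop where
  continuous : Continuous γ
  strictMono : StrictMono γ
  map_zero : γ 0 = 0

/-- Comparison functions of class `K∞`. -/
structure IsClassKInf (γ : ℝ≥0 → ℝ≥0) : Prop extends IsClassK γ where
  unbounded : ¬ BddAbove (Set.range γ)

variable {X 𝒰 : Type*}

/-- The right-hand upper Dini derivative, at time `0`, of `V` along the trajectory of the
transition map `φ` that starts at `x` and has the input `u`. -/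
def diniDerivative (φ : ℝ≥0 → X → 𝒰 → X) (V : X → ℝ) (u : 𝒰) (x : X) : EReal :=
  limsup (fun t : ℝ≥0 => (((V (φ t x u) - V x) / t : ℝ) : EReal)) (𝓝[>] 0)

/-- `V` is a (non-coercive) ISS Lyapunov function for the control system `(X, 𝒰, φ)`. -/
structure IsISSLyapunov [NormedAddCommGroup X] [NormedAddCommGroup 𝒰]
    (φ : ℝ≥0 → X → 𝒰 → X) (V : X → ℝ) : Prop where
  continuous : Continuous V
  nonneg : ∀ x, 0 ≤ V x
  bounds : ∃ ψ₂ : ℝ≥0 → ℝ≥0, IsClassKInf ψ₂ ∧ ∀ x, x ≠ 0 → 0 < V x ∧ V x ≤ ψ₂ ‖x‖₊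
  dissipation : ∃ α σ : ℝ≥0 → ℝ≥0, IsClassKInf α ∧ IsClassK σ ∧
    ∀ (x : X) (u : 𝒰), diniDerivative φ V u x ≤ ((-(α ‖x‖₊ : ℝ) + (σ ‖u‖₊ : ℝ) : ℝ) : EReal)

end Lyapunov

end ISS

end

/-! Write `S` for `A⁻¹` and `Q` for `A†A⁻¹`. Strict dissipativity (c) at `S x` makes V positive off
zero and, incidentally, makes D(A) dense. By (a) and the closed graph theorem `Q` is bounded, and ⟪S
x, h⟫ = ⟪Q x, S h⟫ yields V(x + h) - V(x) = -Re⟪Q x + x + h, S h⟫ (`neg_re_inner_sub`): the whole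
increment of V factors through `S h`.

This smoothing makes V differentiable enough along all trajectories. For h = h₁ + h₂ with h₁ = T(t)x
- x and h₂ the input integral, S h₁ / t tends to x for every x in X, not only in D(A). The norm of S
h₂ / t is at most K‖u‖, since `S` is bounded for the norm of X₋₁ and h₂ is O(t) there. In X itself
h₁ tends to 0, while h₂ need only be bounded by c‖u‖; this follows from admissibility by the closed
graph theorem, uniformly for t ≤ 1. Hence `exists_diniDerivative_le`; hypothesis (b) and Young's
inequality then absorb the mixed terms into -(1 - δ)‖x‖². -/

namespace ISS

/-! ### Bounded inverse of the generator -/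

section Generator

variable {X : Type*} [NormedAddCommGroup X] [NormedSpace ℂ X] {T : C0Semigroup X} {A : X →ₗ.[ℂ] X}

lemma C0Semigroup.apply_add (T : C0Semigroup X) (s t : ℝ≥0) (x : X) :
    T (s + t) x = T s (T t x) :=
  congrArg (fun S : X →L[ℂ] X => S x) (T.map_add' s t)

lemma C0Semigroup.apply_zero (T : C0Semigroup X) (x : X) : T 0 x = x :=
  congrArg (fun S : X →L[ℂ] X => S x) T.map_zero'

lemma C0Semigroup.tendsto_sub_self (T : C0Semigroup X) (x : X) :
    Tendsto (fun t : ℝ≥0 => T t x - x) (𝓝[>] 0) (𝓝 0) := by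
  have h := ((T.continuous' x).tendsto 0).sub_const x
  rw [T.apply_zero, sub_self] at h
  exact h.mono_left nhdsWithin_le_nhds

lemma C0Semigroup.ExponentiallyStable.exists_bound (h : T.ExponentiallyStable) :
    ∃ M : ℝ, 0 ≤ M ∧ ∀ t, ‖T t‖ ≤ M := by
  obtain ⟨M, ω, hω, hM⟩ := h
  have h0 : 0 ≤ M := by
    have := (norm_nonneg _).trans (hM 0)
    simpa using this
  refine ⟨M, h0, fun t => (hM t).trans ?_⟩
  refine mul_le_of_le_one_right h0 (Real.exp_le_one_iff.2 ?_)
  rw [neg_mul]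
  exact neg_nonpos.2 (mul_nonneg hω.le t.coe_nonneg)

/-- The orbit `t ↦ T(t)x`, extended by `x` to negative times. -/
def C0Semigroup.orbit (T : C0Semigroup X) (x : X) (t : ℝ) : X := T t.toNNReal x

lemma C0Semigroup.continuous_orbit (T : C0Semigroup X) (x : X) : Continuous (T.orbit x) :=
  (T.continuous' x).comp continuous_real_toNNReal

lemma C0Semigroup.integrableOn_orbit {M ω : ℝ} (hω : 0 < ω)
    (hM : ∀ t : ℝ≥0, ‖T t‖ ≤ M * Real.exp (-ω * t)) (x : X) :
    IntegrableOn (T.orbit x) (Set.Ioi 0) := by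
  refine Integrable.mono' (((integrableOn_exp_mul_Ioi (neg_lt_zero.2 hω) 0).const_mul M).mul_const
    ‖x‖) (T.continuous_orbit x).aestronglyMeasurable ?_
  refine (ae_restrict_iff' measurableSet_Ioi).2 (.of_forall fun t ht => ?_)
  have := (T t.toNNReal).le_of_opNorm_le (hM _) x
  rwa [Real.coe_toNNReal _ (le_of_lt ht)] at this

lemma C0Semigroup.norm_integral_orbit_le {M ω : ℝ} (hω : 0 < ω)
    (hM : ∀ t : ℝ≥0, ‖T t‖ ≤ M * Real.exp (-ω * t)) (x : X) :
    ‖∫ t in Set.Ioi (0 : ℝ), T.orbit x t‖ ≤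
      (∫ t in Set.Ioi (0 : ℝ), M * Real.exp (-ω * t)) * ‖x‖ := by
  rw [← integral_mul_const]
  refine norm_integral_le_of_norm_le (((integrableOn_exp_mul_Ioi (neg_lt_zero.2 hω) 0).const_mul
    M).mul_const ‖x‖) ((ae_restrict_iff' measurableSet_Ioi).2 (.of_forall fun t ht => ?_))
  have := (T t.toNNReal).le_of_opNorm_le (hM _) x
  rwa [Real.coe_toNNReal _ (le_of_lt ht)] at this

lemma C0Semigroup.apply_integral_orbit [CompleteSpace X] (h : ℝ≥0) {x : X}
    (hx : IntegrableOn (T.orbit x) (Set.Ioi 0)) :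
    T h (∫ t in Set.Ioi (0 : ℝ), T.orbit x t) = ∫ t in Set.Ioi (h : ℝ), T.orbit x t := by
  rw [← ContinuousLinearMap.integral_comp_comm _ hx]
  have h1 := (measurePreserving_add_right (volume : Measure ℝ) (h : ℝ)).setIntegral_preimage_emb
    (measurableEmbedding_addRight (h : ℝ)) (T.orbit x) (Set.Ioi (h : ℝ))
  rw [← h1]
  have h2 : (fun y : ℝ => y + h) ⁻¹' Set.Ioi (h : ℝ) = Set.Ioi 0 := by
    ext y; simp
  rw [h2]
  refine setIntegral_congr_fun measurableSet_Ioi fun t ht => ?_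
  have ht' : 0 ≤ t := le_of_lt ht
  simp only [orbit]
  rw [Real.toNNReal_add ht' h.coe_nonneg, Real.toNNReal_coe, add_comm, T.apply_add]

lemma C0Semigroup.tendsto_average_orbit [CompleteSpace X] (T : C0Semigroup X) (x : X) :
    Tendsto (fun t : ℝ≥0 => (t : ℝ)⁻¹ • ∫ s in (0 : ℝ)..t, T.orbit x s) (𝓝[>] 0) (𝓝 x) := by
  have hc := T.continuous_orbit x
  have h1 := intervalIntegral.integral_hasDerivAt_right (hc.intervalIntegrable 0 0)
    (hc.stronglyMeasurableAtFilter _ _) hc.continuousAt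
  rw [hasDerivAt_iff_tendsto_slope_zero] at h1
  have h2 : T.orbit x 0 = x := by simp [orbit, T.apply_zero]
  simp only [zero_add, intervalIntegral.integral_same, sub_zero, h2] at h1
  refine h1.comp (tendsto_nhdsWithin_iff.2 ⟨?_, ?_⟩)
  · exact (NNReal.continuous_coe.tendsto' 0 0 rfl).mono_left nhdsWithin_le_nhds
  · filter_upwards [self_mem_nhdsWithin] with t ht
    simpa using (ne_of_gt ht : t ≠ 0)

/-- The generator of an exponentially stable semigroup has the bounded inverse
`-∫₀^∞ T(t) dt`. -/
lemma C0Semigroup.ExponentiallyStable.exists_isBoundedInverse [CompleteSpace X] (hA : T.IsGenerator A)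
    (hT : T.ExponentiallyStable) : ∃ S, IsBoundedInverse A S := by
  obtain ⟨M, ω, hω, hM⟩ := hT
  have hint := fun x => C0Semigroup.integrableOn_orbit hω hM x
  let S₀ : X →ₗ[ℂ] X :=
    { toFun := fun x => -∫ t in Set.Ioi (0 : ℝ), T.orbit x t
      map_add' := fun x y => by
        have : T.orbit (x + y) = fun t => T.orbit x t + T.orbit y t := by
          ext t; simp [orbit]
        rw [this, integral_add (hint x) (hint y), neg_add]
      map_smul' := fun c x => by
        have : T.orbit (c • x) = fun t => c • T.orbit x t := by
          ext t; simp [orbit]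
        rw [this, integral_smul, RingHom.id_apply, smul_neg] }
  let S : X →L[ℂ] X := S₀.mkContinuous (∫ t in Set.Ioi (0 : ℝ), M * Real.exp (-ω * t)) fun x => by
    change ‖-∫ t in Set.Ioi (0 : ℝ), T.orbit x t‖ ≤ _
    rw [norm_neg]
    exact C0Semigroup.norm_integral_orbit_le hω hM x
  have hS : ∀ x, S x = -∫ t in Set.Ioi (0 : ℝ), T.orbit x t := fun _ => rfl
  -- Applying T(t) cuts [0, t] off the integral, so the difference quotient at `S x` is the average
  -- of the orbit over [0, t].
  have hlim : ∀ x, Tendsto (fun t : ℝ≥0 => (t : ℝ)⁻¹ • (T t (S x) - S x)) (𝓝[>] 0) (𝓝 x) := by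
    intro x
    refine (T.tendsto_average_orbit x).congr fun t => ?_
    rw [hS, map_neg, C0Semigroup.apply_integral_orbit t (hint x), neg_sub_neg,
      intervalIntegral.integral_Ioi_sub_Ioi (hint x) t.coe_nonneg]
  have hgraph : ∀ x, (S x, x) ∈ A.graph := fun x => (hA _ _).2 (hlim x)
  have hmem : ∀ x, S x ∈ A.domain := fun x => LinearPMap.mem_domain_of_mem_graph (hgraph x)
  have hcomm : ∀ t x, S (T t x) = T t (S x) := by
    intro t x
    rw [hS, hS, map_neg, ← ContinuousLinearMap.integral_comp_comm _ (hint x)]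
    congr 2
    ext s
    simp only [orbit]
    rw [← T.apply_add, ← T.apply_add, add_comm]
  refine ⟨S, hmem, fun x => ?_, fun x => ?_⟩
  · exact A.mem_graph_snd_inj (A.mem_graph ⟨S x, hmem x⟩) (hgraph x) rfl
  · have h1 := (hA _ _).1 (A.mem_graph x)
    -- For x in D(A), `S` of the difference quotients tends to S(Ax); as `S` commutes with T(t), the
    -- same quotients tend to x by `hlim`.
    have h2 := (S.continuous.tendsto _).comp h1
    refine tendsto_nhds_unique h2 ((hlim x).congr fun t => ?_)
    have key : S (((t : ℝ)⁻¹) • (T t (x : X) - x)) = ((t : ℝ)⁻¹) • S (T t (x : X) - x) :=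
      (S.restrictScalars ℝ).map_smul _ _
    simp only [Function.comp_apply, key, map_sub, hcomm]

lemma isBoundedInverse_boundedInverse (h : ∃ S, IsBoundedInverse A S) :
    IsBoundedInverse A (boundedInverse A) := by
  simp only [boundedInverse, dif_pos h]
  exact h.choose_spec

/-- `(A⁻¹T(t)x - A⁻¹x)/t → x` as `t → 0+`. -/
lemma IsBoundedInverse.tendsto_slope {S : X →L[ℂ] X} (hS : IsBoundedInverse A S)
    (hA : T.IsGenerator A) (x : X) :
    Tendsto (fun t : ℝ≥0 => (t : ℝ)⁻¹ • S (T t x - x)) (𝓝[>] 0) (𝓝 x) := by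
  -- Since `S` commutes with T(t), the claim is the generator limit at `S x`, which lies in D(A).
  have hg := A.mem_graph ⟨S x, hS.mem_domain x⟩
  simp only [hS.right_inv] at hg
  refine ((hA _ _).1 hg).congr fun t => ?_
  have hg' := hA.map_mem t hg
  obtain ⟨y, hy, hy'⟩ := (LinearPMap.mem_graph_iff A).1 hg'
  have := hS.left_inv y
  simp only at hy hy'
  rw [hy', hy] at this
  rw [map_sub, this]

/-- With y = (β - A)⁻¹x, applying `S` to x = βy - Ay gives S x = βS y - y. This is what turns an
O(t) bound in X₋₁ into an O(t) bound on `S` of the input integral. -/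
lemma IsBoundedInverse.norm_apply_le_norm_incl {S : X →L[ℂ] X} (hS : IsBoundedInverse A S) {β : ℂ}
    (hβ : β ∈ resolventSet A) (x : X) :
    ‖S x‖ ≤ (‖β‖ * ‖S‖ + 1) * ‖incl A β x‖ := by
  rw [norm_incl]
  have hR := isBoundedInverse_resolvent hβ
  set y := resolvent A β x with hy
  have h1 : β • y - A ⟨y, hR.mem_domain x⟩ = x := hR.right_inv x
  have h2 : S (A ⟨y, hR.mem_domain x⟩) = y := hS.left_inv ⟨y, hR.mem_domain x⟩
  have h3 : S x = β • S y - y := by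
    conv_lhs => rw [← h1]
    rw [map_sub, map_smul, h2]
  rw [h3]
  calc ‖β • S y - y‖ ≤ ‖β • S y‖ + ‖y‖ := norm_sub_le _ _
    _ ≤ ‖β‖ * (‖S‖ * ‖y‖) + ‖y‖ := by
      rw [norm_smul]; gcongr; exact S.le_opNorm y
    _ = _ := by ring

end Generator

/-! ### Dissipativity and the operator A†A⁻¹ -/

section Adjoint

variable {X : Type*} [NormedAddCommGroup X] [InnerProductSpace ℂ X]
  {A : X →ₗ.[ℂ] X} {S : X →L[ℂ] X}

lemma IsBoundedInverse.apply_ne_zero (hS : IsBoundedInverse A S) {x : X} (hx : x ≠ 0) :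
    S x ≠ 0 := by
  intro h
  have h1 : (⟨S x, hS.mem_domain x⟩ : A.domain) = 0 := Subtype.ext h
  have h2 := hS.right_inv x
  rw [h1, LinearPMap.map_zero] at h2
  exact hx h2.symm

lemma IsBoundedInverse.re_inner_neg (hS : IsBoundedInverse A S)
    (hdiss : ∀ x : A.domain, (x : X) ≠ 0 → (⟪A x, (x : X)⟫_ℂ).re < 0) {x : X} (hx : x ≠ 0) :
    (⟪S x, x⟫_ℂ).re < 0 := by
  have h := hdiss ⟨S x, hS.mem_domain x⟩ (hS.apply_ne_zero hx)
  rw [hS.right_inv, ← inner_conj_symm, Complex.conj_re] at h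
  exact h

/-- A nonzero y orthogonal to D(A) would satisfy ⟪S y, y⟫ = 0, against strict dissipativity. -/
lemma IsBoundedInverse.dense_domain [CompleteSpace X] (hS : IsBoundedInverse A S)
    (hdiss : ∀ x : A.domain, (x : X) ≠ 0 → (⟪A x, (x : X)⟫_ℂ).re < 0) :
    Dense (A.domain : Set X) := by
  rw [Submodule.dense_iff_topologicalClosure_eq_top, Submodule.topologicalClosure_eq_top_iff,
    Submodule.eq_bot_iff]
  intro y hy
  by_contra h
  have h1 := hS.re_inner_neg hdiss h
  rw [(Submodule.mem_orthogonal _ _).1 hy _ (hS.mem_domain y)] at h1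
  exact lt_irrefl _ h1

/-- If `D(A) ⊆ D(A†)`, then `A† A⁻¹` is a bounded operator. -/
lemma IsBoundedInverse.exists_adjoint_comp [CompleteSpace X] (hS : IsBoundedInverse A S)
    (hd : Dense (A.domain : Set X)) (hdom : A.domain ≤ A†.domain) :
    ∃ Q : X →L[ℂ] X, ∀ x, Q x = A† ⟨S x, hdom (hS.mem_domain x)⟩ := by
  let g : X →ₗ[ℂ] X := A†.toFun ∘ₗ
    (S.toLinearMap.codRestrict A†.domain fun x => hdom (hS.mem_domain x))
  have hg : ∀ (x : X) (w : A.domain), ⟪g x, (w : X)⟫_ℂ = ⟪S x, A w⟫_ℂ := fun x w =>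
    LinearPMap.adjoint_isFormalAdjoint hd ⟨S x, hdom (hS.mem_domain x)⟩ w
  -- The graph is closed because pairing `g x` with w in the dense set D(A) gives ⟪S x, A w⟫, which
  -- is continuous in x.
  refine ⟨⟨g, g.continuous_of_seq_closed_graph fun u x y hu hgu => ?_⟩, fun _ => rfl⟩
  refine hd.eq_of_inner_left (𝕜 := ℂ) fun w hw => ?_
  rw [hg x ⟨w, hw⟩]
  refine tendsto_nhds_unique (hgu.inner tendsto_const_nhds)
    ((((S.continuous.tendsto x).comp hu).inner tendsto_const_nhds).congr fun n => ?_)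
  exact (hg (u n) ⟨w, hw⟩).symm

end Adjoint

/-! ### The extended semigroup on X₋₁ -/

section Extrapolation

variable {X : Type*} [NormedAddCommGroup X] [NormedSpace ℂ X] {T : C0Semigroup X} {A : X →ₗ.[ℂ] X}
  {β : ℂ}

/-- The inclusion `X → X₋₁` as a bounded operator. -/
noncomputable def inclL (A : X →ₗ.[ℂ] X) (β : ℂ) : X →L[ℂ] Extrapolation A β :=
  LinearMap.mkContinuous
    { toFun := incl A β
      map_add' := fun x y => by simp [incl, UniformSpace.Completion.coe_add]
      map_smul' := fun c x => by simp [incl, UniformSpace.Completion.coe_smul] }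
    ‖resolvent A β‖ fun x => (norm_incl A β x).trans_le ((resolvent A β).le_opNorm x)

lemma inclL_apply (x : X) : inclL A β x = incl A β x := rfl

lemma denseRange_incl (A : X →ₗ.[ℂ] X) (β : ℂ) : DenseRange (incl A β) :=
  UniformSpace.Completion.denseRange_coe.comp (toCore A β).surjective.denseRange
    (UniformSpace.Completion.continuous_coe _)

lemma norm_extSemigroup_apply_le (hA : T.IsGenerator A) (hβ : β ∈ resolventSet A) (t : ℝ≥0)
    (z : Extrapolation A β) : ‖extSemigroup hA hβ t z‖ ≤ ‖T t‖ * ‖z‖ := by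
  refine (denseRange_incl A β).induction_on z (isClosed_le (by fun_prop) (by fun_prop)) fun x => ?_
  rw [extSemigroup_incl, norm_incl, norm_incl, resolvent_comm hA hβ]
  exact (T t).le_opNorm _

/-- Strong continuity on the dense image of X extends by the uniform Lipschitz bound. Joint
continuity serves the measurability of the integrand for merely measurable inputs. -/
lemma continuous_extSemigroup_uncurry (hA : T.IsGenerator A) (hβ : β ∈ resolventSet A) {M : ℝ}
    (hM : ∀ t, ‖T t‖ ≤ M) :
    Continuous fun p : ℝ≥0 × Extrapolation A β => extSemigroup hA hβ p.1 p.2 := by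
  refine continuous_prod_of_dense_continuous_lipschitzWith' _ M.toNNReal
    (denseRange_incl A β) (fun t => ?_) ?_
  · refine LipschitzWith.of_dist_le' fun x y => ?_
    rw [dist_eq_norm, dist_eq_norm, ← map_sub]
    exact (norm_extSemigroup_apply_le hA hβ t _).trans (by gcongr; exact hM t)
  · rintro _ ⟨x, rfl⟩
    simp only [extSemigroup_incl]
    exact (inclL A β).continuous.comp (T.continuous' x)

end Extrapolation

/-! ### Boundedness of the input maps -/

section Input

variable {X U : Type*} [NormedAddCommGroup X] [NormedSpace ℂ X]
  [NormedAddCommGroup U] {T : C0Semigroup X} {A : X →ₗ.[ℂ] X} {β : ℂ}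

lemma ae_norm_input_le (u : Input U ⊤) : ∀ᵐ s : ℝ, 0 ≤ s → ‖u s‖ ≤ ‖u‖ := by
  refine (ae_restrict_iff' measurableSet_Ici).1 ?_
  filter_upwards [ae_le_eLpNormEssSup (f := u)] with s hs
  rw [Lp.norm_def, ← toReal_enorm]
  exact ENNReal.toReal_mono (Lp.eLpNorm_ne_top u) (by rwa [eLpNorm_exponent_top])

/-- The input `u` delayed by the time `d`. -/
lemma exists_delay {q : ℝ≥0∞} (u : Input U q) (d : ℝ) :
    ∃ w : Input U q, ‖w‖ ≤ ‖u‖ ∧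
      ∀ᵐ s : ℝ, 0 ≤ s → w s = (Set.Ioi (0 : ℝ)).indicator u (s - d) := by
  have hμ : (volume : Measure ℝ).restrict (Set.Ioi 0) = (volume : Measure ℝ).restrict (Set.Ici 0) :=
    Measure.restrict_congr_set Ioi_ae_eq_Ici
  have hu := Lp.memLp u
  -- The cutoff discards the arbitrary values of the representative of u at negative times.
  have h1 : MemLp ((Set.Ioi (0 : ℝ)).indicator u) q volume := by
    rw [memLp_indicator_iff_restrict measurableSet_Ioi, hμ]
    exact hu
  have hd := measurePreserving_sub_right (volume : Measure ℝ) d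
  have h2 := (h1.comp_measurePreserving hd).restrict (Set.Ici 0)
  refine ⟨h2.toLp, ?_, (ae_restrict_iff' measurableSet_Ici).1 h2.coeFn_toLp⟩
  rw [Lp.norm_toLp, Lp.norm_def]
  refine ENNReal.toReal_mono (Lp.eLpNorm_ne_top u) ((eLpNorm_restrict_le _ _ _ _).trans ?_)
  rw [eLpNorm_comp_measurePreserving h1.1 hd,
    eLpNorm_indicator_eq_eLpNorm_restrict measurableSet_Ioi, hμ]

variable [NormedSpace ℂ U]

/-- The delayed input vanishes up to time τ - t and then replays u, so time τ reproduces the state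
reached at time t. -/
lemma inputIntegral_delay (hA : T.IsGenerator A) (hβ : β ∈ resolventSet A)
    (B : U →L[ℂ] Extrapolation A β) {t τ : ℝ≥0} (htτ : t ≤ τ) (u w : ℝ → U)
    (hw : ∀ᵐ s : ℝ, 0 ≤ s → w s = (Set.Ioi (0 : ℝ)).indicator u (s - (τ - t))) :
    inputIntegral hA hβ B τ w = inputIntegral hA hβ B t u := by
  set v := (Set.Ioi (0 : ℝ)).indicator u with hv
  set f : ℝ → Extrapolation A β := fun s => extSemigroup hA hβ (Real.toNNReal (t - s)) (B (u s))
  have hvf : ∀ s, extSemigroup hA hβ (Real.toNNReal (t - s)) (B (v s))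
      = (Set.Ioi (0 : ℝ)).indicator f s := by
    intro s
    by_cases hs : s ∈ Set.Ioi (0 : ℝ)
    · simp [hv, f, Set.indicator_of_mem hs]
    · simp [hv, Set.indicator_of_notMem hs]
  have h1 : inputIntegral hA hβ B τ w
      = ∫ s in (0 : ℝ)..τ, (Set.Ioi (0 : ℝ)).indicator f (s - (τ - t)) := by
    refine intervalIntegral.integral_congr_ae (hw.mono fun s hs hs' => ?_)
    rw [Set.uIoc_of_le τ.coe_nonneg] at hs'
    rw [hs hs'.1.le, ← hvf]
    congr 3
    ring
  rw [h1, intervalIntegral.integral_comp_sub_right]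
  have h2 : (τ : ℝ) - (τ - t) = t := by ring
  have h3 : (t : ℝ) ≤ τ := htτ
  have h4 : Set.Ioc (0 - ((τ : ℝ) - t)) t ∩ Set.Ioi 0 = Set.Ioc 0 (t : ℝ) := by
    ext s
    simp only [Set.mem_inter_iff, Set.mem_Ioc, Set.mem_Ioi]
    exact ⟨fun h => ⟨h.2, h.1.2⟩, fun h => ⟨⟨by linarith [h.1], h.2⟩, h.1⟩⟩
  rw [h2, inputIntegral, intervalIntegral.integral_of_le (by linarith [t.coe_nonneg]),
    intervalIntegral.integral_of_le t.coe_nonneg, setIntegral_indicator measurableSet_Ioi, h4]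

variable {M : ℝ}

lemma ae_norm_integrand_le (hA : T.IsGenerator A) (hβ : β ∈ resolventSet A)
    (hM : ∀ t, ‖T t‖ ≤ M) (B : U →L[ℂ] Extrapolation A β) (t : ℝ≥0) (u : Input U ⊤) :
    ∀ᵐ s : ℝ, s ∈ Set.uIoc (0 : ℝ) t →
      ‖extSemigroup hA hβ (Real.toNNReal (t - s)) (B (u s))‖ ≤ M * (‖B‖ * ‖u‖) := by
  have hM0 : 0 ≤ M := (norm_nonneg _).trans (hM 0)
  filter_upwards [ae_norm_input_le u] with s hs hst
  rw [Set.uIoc_of_le t.coe_nonneg] at hst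
  calc _ ≤ ‖T (Real.toNNReal (t - s))‖ * ‖B (u s)‖ := norm_extSemigroup_apply_le hA hβ _ _
    _ ≤ M * (‖B‖ * ‖u‖) := by
      gcongr
      · exact hM _
      · exact (B.le_opNorm _).trans (by gcongr; exact hs hst.1.le)

lemma norm_inputIntegral_le (hA : T.IsGenerator A) (hβ : β ∈ resolventSet A)
    (hM : ∀ t, ‖T t‖ ≤ M) (B : U →L[ℂ] Extrapolation A β) (t : ℝ≥0) (u : Input U ⊤) :
    ‖inputIntegral hA hβ B t u‖ ≤ M * (‖B‖ * ‖u‖) * t := by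
  have := intervalIntegral.norm_integral_le_of_norm_le_const_ae
    (ae_norm_integrand_le hA hβ hM B t u)
  rwa [sub_zero, abs_of_nonneg t.coe_nonneg] at this

lemma intervalIntegrable_integrand (hA : T.IsGenerator A) (hβ : β ∈ resolventSet A)
    (hM : ∀ t, ‖T t‖ ≤ M) (B : U →L[ℂ] Extrapolation A β) (t : ℝ≥0) (u : Input U ⊤) :
    IntervalIntegrable (fun s => extSemigroup hA hβ (Real.toNNReal (t - s)) (B (u s)))
      volume 0 t := by
  have hu : AEStronglyMeasurable u (volume.restrict (Set.uIoc (0 : ℝ) t)) := by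
    refine (Lp.aestronglyMeasurable u).mono_measure (Measure.restrict_mono ?_ le_rfl)
    rw [Set.uIoc_of_le t.coe_nonneg]
    exact fun s hs => hs.1.le
  have hc : Continuous fun s : ℝ => Real.toNNReal (t - s) :=
    continuous_real_toNNReal.comp (continuous_const.sub continuous_id)
  have hp : AEStronglyMeasurable (fun s : ℝ => (Real.toNNReal (t - s), B (u s)))
      (volume.restrict (Set.uIoc (0 : ℝ) t)) :=
    hc.aestronglyMeasurable.prodMk (B.continuous.comp_aestronglyMeasurable hu)
  have hm := (continuous_extSemigroup_uncurry hA hβ hM).comp_aestronglyMeasurable hp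
  have hfin : volume (Set.uIoc (0 : ℝ) t) ≠ ∞ := by
    rw [Set.uIoc_of_le t.coe_nonneg]
    exact measure_Ioc_lt_top.ne
  exact intervalIntegrable_iff.2 (Integrable.mono' (integrableOn_const hfin) hm
    ((ae_restrict_iff' measurableSet_uIoc).2 (ae_norm_integrand_le hA hβ hM B t u)))

lemma inputIntegral_congr (hA : T.IsGenerator A) (hβ : β ∈ resolventSet A)
    (B : U →L[ℂ] Extrapolation A β) (t : ℝ≥0) {u v : ℝ → U}
    (huv : u =ᵐ[(volume : Measure ℝ).restrict (Set.Ici 0)] v) :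
    inputIntegral hA hβ B t u = inputIntegral hA hβ B t v := by
  refine intervalIntegral.integral_congr_ae
    (((ae_restrict_iff' measurableSet_Ici).1 huv).mono fun s hs hst => ?_)
  rw [Set.uIoc_of_le t.coe_nonneg] at hst
  rw [hs hst.1.le]

lemma inputIntegral_add (hA : T.IsGenerator A) (hβ : β ∈ resolventSet A)
    (hM : ∀ t, ‖T t‖ ≤ M) (B : U →L[ℂ] Extrapolation A β) (t : ℝ≥0) (u v : Input U ⊤) :
    inputIntegral hA hβ B t (u + v : Input U ⊤)
      = inputIntegral hA hβ B t u + inputIntegral hA hβ B t v := by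
  rw [inputIntegral_congr hA hβ B t (Lp.coeFn_add u v), inputIntegral, inputIntegral, inputIntegral,
    ← intervalIntegral.integral_add (intervalIntegrable_integrand hA hβ hM B t u)
      (intervalIntegrable_integrand hA hβ hM B t v)]
  simp

lemma inputIntegral_smul (hA : T.IsGenerator A) (hβ : β ∈ resolventSet A)
    (B : U →L[ℂ] Extrapolation A β) (t : ℝ≥0) (c : ℂ) (u : Input U ⊤) :
    inputIntegral hA hβ B t (c • u : Input U ⊤) = c • inputIntegral hA hβ B t u := by
  rw [inputIntegral_congr hA hβ B t (Lp.coeFn_smul c u), inputIntegral, inputIntegral,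
    ← intervalIntegral.integral_smul]
  simp

/-- The input map `u ↦ ∫₀ᵗ T₋₁(t-s) B u(s) ds` of an admissible control operator is bounded
as a map to `X`. -/
lemma IsAdmissible.exists_bound [CompleteSpace X] [CompleteSpace U] {hA : T.IsGenerator A}
    {hβ : β ∈ resolventSet A} (hM : ∀ t, ‖T t‖ ≤ M) {B : U →L[ℂ] Extrapolation A β}
    (hB : IsAdmissible hA hβ B ⊤) (t : ℝ≥0) :
    ∃ c : ℝ, 0 ≤ c ∧ ∀ (u : Input U ⊤) (x : X),
      incl A β x = inputIntegral hA hβ B t u → ‖x‖ ≤ c * ‖u‖ := by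
  have hinj := incl_injective hβ
  choose g hg using hB t
  let G : Input U ⊤ →ₗ[ℂ] X :=
    { toFun := g
      map_add' := fun u v => hinj (by
        rw [← inclL_apply (g u + g v), map_add, inclL_apply, inclL_apply, hg, hg, hg,
          inputIntegral_add hA hβ hM])
      map_smul' := fun c u => hinj (by
        rw [RingHom.id_apply, ← inclL_apply (c • g u), map_smul, inclL_apply, hg, hg,
          inputIntegral_smul]) }
  let J : Input U ⊤ →ₗ[ℂ] Extrapolation A β := (inclL A β).toLinearMap ∘ₗ G
  have hJ : ∀ u, J u = inputIntegral hA hβ B t u := hg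
  have hJc : Continuous J := AddMonoidHomClass.continuous_of_bound J (M * ‖B‖ * t) fun u => by
    rw [hJ]
    exact (norm_inputIntegral_le hA hβ hM B t u).trans_eq (by ring)
  -- Closed graph theorem: after the continuous injection into X₋₁ the map becomes the continuous
  -- `J`, so limits in X are determined.
  have hG : Continuous G := G.continuous_of_seq_closed_graph fun u u₀ y hu hy => by
    have h1 : Tendsto (fun n => J (u n)) atTop (𝓝 (inclL A β y)) :=
      ((inclL A β).continuous.tendsto y).comp hy
    have h2 : Tendsto (fun n => J (u n)) atTop (𝓝 (J u₀)) := (hJc.tendsto u₀).comp hu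
    exact hinj (tendsto_nhds_unique h1 h2)
  let L : Input U ⊤ →L[ℂ] X := ⟨G, hG⟩
  refine ⟨‖L‖, norm_nonneg _, fun u x hx => ?_⟩
  have : x = L u := hinj (hx.trans (hg u).symm)
  rw [this]
  exact L.le_opNorm u

/-- The bounds of the input maps are uniform on bounded time intervals. -/
lemma IsAdmissible.exists_uniform_bound [CompleteSpace X] [CompleteSpace U] {hA : T.IsGenerator A}
    {hβ : β ∈ resolventSet A} (hM : ∀ t, ‖T t‖ ≤ M) {B : U →L[ℂ] Extrapolation A β}
    (hB : IsAdmissible hA hβ B ⊤) (τ : ℝ≥0) :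
    ∃ c : ℝ, 0 ≤ c ∧ ∀ t ≤ τ, ∀ (u : Input U ⊤) (x : X),
      incl A β x = inputIntegral hA hβ B t u → ‖x‖ ≤ c * ‖u‖ := by
  obtain ⟨c, hc, h⟩ := hB.exists_bound hM τ
  refine ⟨c, hc, fun t ht u x hx => ?_⟩
  -- Delaying u by τ - t does not increase its norm, so the constant for τ serves all t ≤ τ.
  obtain ⟨w, hwu, hw⟩ := exists_delay u ((τ : ℝ) - t)
  exact (h w x (hx.trans (inputIntegral_delay hA hβ B ht u w hw).symm)).trans (by gcongr)

end Input

lemma isClassKInf_mul_sq {c : ℝ≥0} (hc : 0 < c) : IsClassKInf fun r => c * r ^ 2 where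
  continuous := by fun_prop
  strictMono := fun a b h => by
    have : a ^ 2 < b ^ 2 := pow_lt_pow_left₀ h zero_le two_ne_zero
    exact mul_lt_mul_of_pos_left this hc
  map_zero := by simp
  unbounded := by
    refine Filter.not_bddAbove_of_tendsto_atTop (l := atTop) ?_
    exact Filter.Tendsto.const_mul_atTop hc (tendsto_pow_atTop two_ne_zero)

/-! ### Increments of the quadratic form -/

section Quadratic

variable {X : Type*} [NormedAddCommGroup X] [InnerProductSpace ℂ X] {A : X →ₗ.[ℂ] X} {S : X →L[ℂ] X}

/-- If `Q = A† A⁻¹`, the increment of `-Re⟪A⁻¹x, x⟫` factors through `A⁻¹h`. -/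
lemma neg_re_inner_sub {Q : X →L[ℂ] X} (hQ : ∀ x h : X, ⟪S x, h⟫_ℂ = ⟪Q x, S h⟫_ℂ) (x h : X) :
    -(⟪S (x + h), x + h⟫_ℂ).re - -(⟪S x, x⟫_ℂ).re = -(⟪Q x + x + h, S h⟫_ℂ).re := by
  have e1 : (⟪S h, x⟫_ℂ).re = (⟪x, S h⟫_ℂ).re := inner_re_symm (𝕜 := ℂ) _ _
  have e2 : (⟪S h, h⟫_ℂ).re = (⟪h, S h⟫_ℂ).re := inner_re_symm (𝕜 := ℂ) _ _
  simp only [map_add, inner_add_left, inner_add_right, Complex.add_re, hQ x h, e1, e2]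
  ring

/-- Only ⟪p, k₁⟫ is kept exact, because k₁ will converge and produce the dissipation; k₂ and h₂ are
merely bounded by the input, so Cauchy–Schwarz suffices. -/
lemma neg_re_inner_add_le (p h₁ h₂ k₁ k₂ : X) :
    -(⟪p + (h₁ + h₂), k₁ + k₂⟫_ℂ).re ≤
      -(⟪p, k₁⟫_ℂ).re + ‖p‖ * ‖k₂‖ + (‖h₁‖ + ‖h₂‖) * (‖k₁‖ + ‖k₂‖) := by
  have e1 : -(⟪p, k₂⟫_ℂ).re ≤ ‖p‖ * ‖k₂‖ :=
    (neg_le_abs _).trans ((Complex.abs_re_le_norm _).trans (norm_inner_le_norm _ _))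
  have e2 : -(⟪h₁ + h₂, k₁ + k₂⟫_ℂ).re ≤ (‖h₁‖ + ‖h₂‖) * (‖k₁‖ + ‖k₂‖) :=
    (neg_le_abs _).trans ((Complex.abs_re_le_norm _).trans ((norm_inner_le_norm _ _).trans
      (mul_le_mul (norm_add_le _ _) (norm_add_le _ _) (norm_nonneg _) (by positivity))))
  rw [inner_add_left, Complex.add_re, inner_add_right (𝕜 := ℂ) p, Complex.add_re]
  linarith

end Quadratic

/-! ### Dini derivative along trajectories -/

section Dissipation

variable {X U : Type*} [NormedAddCommGroup X] [InnerProductSpace ℂ X] [CompleteSpace X]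
  [NormedAddCommGroup U] [NormedSpace ℂ U] [CompleteSpace U]
  {T : C0Semigroup X} {A : X →ₗ.[ℂ] X} {S : X →L[ℂ] X} {β : ℂ}

/-- The Dini derivative of `-Re⟪A⁻¹x, x⟫` along the trajectories is bounded by the formal
derivative plus terms that are controlled by the norm of the input. -/
lemma exists_diniDerivative_le {hA : T.IsGenerator A} {hβ : β ∈ resolventSet A} {M : ℝ}
    (hM : ∀ t, ‖T t‖ ≤ M) (hS : IsBoundedInverse A S) {Q : X →L[ℂ] X}
    (hQ : ∀ x h : X, ⟪S x, h⟫_ℂ = ⟪Q x, S h⟫_ℂ) {B : U →L[ℂ] Extrapolation A β}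
    (hB : IsAdmissible hA hβ B ⊤) :
    ∃ c K : ℝ, 0 ≤ c ∧ 0 ≤ K ∧ ∀ (x : X) (u : Input U ⊤),
      diniDerivative (transition hB) (fun x => -(⟪S x, x⟫_ℂ).re) u x ≤
        ((-(⟪Q x, x⟫_ℂ).re - ‖x‖ ^ 2 + ‖Q x + x‖ * (K * ‖u‖) +
          c * ‖u‖ * (‖x‖ + K * ‖u‖) : ℝ) : EReal) := by
  obtain ⟨c, hc, hcu⟩ := hB.exists_uniform_bound hM 1
  have hM0 : 0 ≤ M := (norm_nonneg _).trans (hM 0)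
  set C := ‖β‖ * ‖S‖ + 1 with hC
  have hC0 : 0 ≤ C := by positivity
  refine ⟨c, C * (M * ‖B‖), hc, by positivity, fun x u => ?_⟩
  set K := C * (M * ‖B‖) with hK
  have hK0 : 0 ≤ K := by positivity
  set h₁ : ℝ≥0 → X := fun t => T t x - x with hh₁
  set h₂ : ℝ≥0 → X := fun t => (hB t u).choose with hh₂
  set k₁ : ℝ≥0 → X := fun t => (t : ℝ)⁻¹ • S (h₁ t) with hk₁
  set k₂ : ℝ≥0 → X := fun t => (t : ℝ)⁻¹ • S (h₂ t) with hk₂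
  have lim_h : Tendsto h₁ (𝓝[>] 0) (𝓝 0) := T.tendsto_sub_self x
  have lim_k : Tendsto k₁ (𝓝[>] 0) (𝓝 x) := hS.tendsto_slope hA x
  -- A majorant of the difference quotient in which the input parts are replaced by their bounds;
  -- unlike the quotient, it has a limit as t → 0+.
  let G : ℝ≥0 → ℝ := fun t => -(⟪Q x + x, k₁ t⟫_ℂ).re + ‖Q x + x‖ * (K * ‖u‖) +
    (‖h₁ t‖ + c * ‖u‖) * (‖k₁ t‖ + K * ‖u‖)
  have hG : Tendsto G (𝓝[>] 0) (𝓝 (-(⟪Q x, x⟫_ℂ).re - ‖x‖ ^ 2 + ‖Q x + x‖ * (K * ‖u‖) +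
      c * ‖u‖ * (‖x‖ + K * ‖u‖))) := by
    have e : -(⟪Q x, x⟫_ℂ).re - ‖x‖ ^ 2 + ‖Q x + x‖ * (K * ‖u‖) + c * ‖u‖ * (‖x‖ + K * ‖u‖)
        = -(⟪Q x + x, x⟫_ℂ).re + ‖Q x + x‖ * (K * ‖u‖) +
          (‖(0 : X)‖ + c * ‖u‖) * (‖x‖ + K * ‖u‖) := by
      have : (⟪x, x⟫_ℂ).re = ‖x‖ ^ 2 := inner_self_eq_norm_sq (𝕜 := ℂ) x
      rw [inner_add_left, Complex.add_re, this, norm_zero]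
      ring
    rw [e]
    exact (((Complex.continuous_re.tendsto _).comp (tendsto_const_nhds.inner lim_k)).neg.add_const
      _).add ((lim_h.norm.add_const _).mul (lim_k.norm.add_const _))
  have hle : ∀ᶠ t : ℝ≥0 in 𝓝[>] 0,
      (-(⟪S (transition hB t x u), transition hB t x u⟫_ℂ).re - -(⟪S x, x⟫_ℂ).re) / t ≤ G t := by
    filter_upwards [self_mem_nhdsWithin, nhdsWithin_le_nhds (Iic_mem_nhds zero_lt_one)] with t ht ht1
    have ht0 : (0 : ℝ) < t := ht
    have hincl : incl A β (h₂ t) = inputIntegral hA hβ B t u := (hB t u).choose_spec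
    have b₂ : ‖h₂ t‖ ≤ c * ‖u‖ := hcu t ht1 u _ hincl
    have b₃ : ‖k₂ t‖ ≤ K * ‖u‖ := by
      -- The factor t in the X₋₁ bound of the input integral cancels the t⁻¹.
      rw [hk₂, norm_smul, norm_inv, Real.norm_of_nonneg ht0.le, inv_mul_le_iff₀ ht0]
      calc ‖S (h₂ t)‖ ≤ C * ‖incl A β (h₂ t)‖ := hS.norm_apply_le_norm_incl hβ _
        _ ≤ C * (M * (‖B‖ * ‖u‖) * t) := by
          rw [hincl]; gcongr; exact norm_inputIntegral_le hA hβ hM B t u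
        _ = t * (K * ‖u‖) := by rw [hK]; ring
    have e1 : transition hB t x u = x + (h₁ t + h₂ t) := by
      simp only [transition, hh₁, hh₂]; abel
    have e2 : k₁ t + k₂ t = (t : ℝ)⁻¹ • S (h₁ t + h₂ t) := by
      simp only [hk₁, hk₂, map_add, smul_add]
    have e3 : -(⟪Q x + x + (h₁ t + h₂ t), S (h₁ t + h₂ t)⟫_ℂ).re / t
        = -(⟪Q x + x + (h₁ t + h₂ t), k₁ t + k₂ t⟫_ℂ).re := by
      rw [e2, RCLike.real_smul_eq_coe_smul (K := ℂ), inner_smul_right, RCLike.ofReal_eq_complex_ofReal,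
        Complex.re_ofReal_mul, div_eq_inv_mul, mul_neg]
    rw [e1, neg_re_inner_sub hQ, e3]
    refine (neg_re_inner_add_le _ _ _ _ _).trans ?_
    simp only [G]
    gcongr
  refine (limsup_le_limsup (hle.mono fun t ht => EReal.coe_le_coe_iff.2 ht)).trans_eq ?_
  exact ((continuous_coe_real_ereal.tendsto _).comp hG).limsup_eq

end Dissipation

end ISS

/-! ### The Lyapunov function -/

theorem mainTheorem7 {X : Type*} [NormedAddCommGroup X] [InnerProductSpace ℂ X] [CompleteSpace X]
    (T : ISS.C0Semigroup X) (A : X →ₗ.[ℂ] X) (hA : T.IsGenerator A)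
    (hstab : T.ExponentiallyStable)
    (hdom : A.domain ≤ A†.domain)
    (hsect : ∃ δ : ℝ, δ < 1 ∧ ∀ (x : X) (y : A†.domain), (y : X) = ISS.boundedInverse A x →
      0 ≤ (⟪A† y, x⟫_ℂ).re + δ * ‖x‖ ^ 2)
    (hdiss : ∀ x : A.domain, (x : X) ≠ 0 → (⟪A x, (x : X)⟫_ℂ).re < 0) :
    ISS.IsBoundedInverse A (ISS.boundedInverse A) ∧
    ∀ (U : Type*) [NormedAddCommGroup U] [NormedSpace ℂ U] [CompleteSpace U]
      (β : ℂ) (hβ : β ∈ ISS.resolventSet A) (B : U →L[ℂ] ISS.Extrapolation A β)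
      (hB : ISS.IsAdmissible hA hβ B ⊤),
      ISS.IsISSLyapunov (ISS.transition hB) (fun x => -(⟪ISS.boundedInverse A x, x⟫_ℂ).re) := by
  have hS := ISS.isBoundedInverse_boundedInverse (hstab.exists_isBoundedInverse hA)
  refine ⟨hS, fun U _ _ _ β hβ B hB => ?_⟩
  set S := ISS.boundedInverse A
  -- Density is what makes `A†` the genuine adjoint.
  have hdense := hS.dense_domain hdiss
  obtain ⟨Q, hQ⟩ := hS.exists_adjoint_comp hdense hdom
  obtain ⟨δ, hδ, hsect⟩ := hsect
  obtain ⟨M, -, hM⟩ := hstab.exists_bound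
  have hQS : ∀ x h : X, ⟪S x, h⟫_ℂ = ⟪Q x, S h⟫_ℂ := by
    intro x h
    have := LinearPMap.adjoint_isFormalAdjoint hdense ⟨S x, hdom (hS.mem_domain x)⟩
      ⟨S h, hS.mem_domain h⟩
    rw [hS.right_inv, ← hQ] at this
    exact this.symm
  have hpos : ∀ x : X, x ≠ 0 → 0 < -(⟪S x, x⟫_ℂ).re := fun x hx =>
    neg_pos.2 (hS.re_inner_neg hdiss hx)
  refine ⟨?_, fun x => ?_, ⟨fun r => (‖S‖₊ + 1) * r ^ 2, ISS.isClassKInf_mul_sq (by positivity),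
    fun x hx => ⟨hpos x hx, ?_⟩⟩, ?_⟩
  · exact (Complex.continuous_re.comp (S.continuous.inner continuous_id)).neg
  · rcases eq_or_ne x 0 with rfl | hx
    · simp
    · exact (hpos x hx).le
  · have h1 : -(⟪S x, x⟫_ℂ).re ≤ ‖S x‖ * ‖x‖ :=
      (neg_le_abs _).trans ((Complex.abs_re_le_norm _).trans (norm_inner_le_norm _ _))
    have h2 := mul_le_mul_of_nonneg_right (S.le_opNorm x) (norm_nonneg x)
    push_cast
    nlinarith [sq_nonneg ‖x‖]
  · obtain ⟨c, K, hc, hK, hV⟩ := ISS.exists_diniDerivative_le hM hS hQS hB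
    -- `D` collects the coefficients of ‖x‖‖u‖. Of the margin 1 - δ = 2ε, one ε absorbs this term by
    -- Young's inequality and the other gives α. In `F`, cK is the remaining coefficient of ‖u‖²,
    -- and the added 1 keeps σ strictly increasing even when D and cK vanish.
    set D := (‖Q‖ + 1) * K + c with hD
    set ε := (1 - δ) / 2 with hε
    have hε0 : 0 < ε := by rw [hε]; linarith
    set F := D ^ 2 / (4 * ε) + c * K + 1 with hF
    have hF0 : 0 < F := by positivity
    refine ⟨fun r => ε.toNNReal * r ^ 2, fun r => F.toNNReal * r ^ 2,
      ISS.isClassKInf_mul_sq (Real.toNNReal_pos.2 hε0),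
      (ISS.isClassKInf_mul_sq (Real.toNNReal_pos.2 hF0)).toIsClassK, fun x u => ?_⟩
    refine (hV x u).trans (EReal.coe_le_coe_iff.2 ?_)
    have h1 : 0 ≤ (⟪Q x, x⟫_ℂ).re + δ * ‖x‖ ^ 2 := by
      rw [hQ]; exact hsect x ⟨S x, _⟩ rfl
    have h2 : ‖Q x + x‖ ≤ (‖Q‖ + 1) * ‖x‖ :=
      (norm_add_le _ _).trans (by linarith [Q.le_opNorm x])
    have h3 : ‖Q x + x‖ * (K * ‖u‖) ≤ (‖Q‖ + 1) * ‖x‖ * (K * ‖u‖) := by gcongr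
    have h4 : D * ‖x‖ * ‖u‖ ≤ ε * ‖x‖ ^ 2 + D ^ 2 / (4 * ε) * ‖u‖ ^ 2 := by
      have : ε * ‖x‖ ^ 2 + D ^ 2 / (4 * ε) * ‖u‖ ^ 2 - D * ‖x‖ * ‖u‖
          = ε * (‖x‖ - D / (2 * ε) * ‖u‖) ^ 2 := by
        field_simp; ring
      nlinarith [mul_nonneg hε0.le (sq_nonneg (‖x‖ - D / (2 * ε) * ‖u‖))]
    push_cast
    rw [Real.coe_toNNReal _ hε0.le, Real.coe_toNNReal _ hF0.le]
    have h5 : δ = 1 - 2 * ε := by rw [hε]; ring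
    rw [h5] at h1
    have h6 : F * ‖u‖ ^ 2 = D ^ 2 / (4 * ε) * ‖u‖ ^ 2 + c * K * ‖u‖ ^ 2 + ‖u‖ ^ 2 := by
      rw [hF]; ring
    rw [hD] at h4
    rw [hD] at h6
    nlinarith [sq_nonneg ‖u‖]
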